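/- Let $S$ be a finite set and $f\colon 2^S\to\mathbb{R}_{\ge 0}$ be normalized ($f(\emptyset)=0$), monotone ($A\subseteq B$ implies $f(A)\le f(B)$) and submodular ($f(A\cup\{s\})-f(A)\ge f(B\cup\{s\})-f(B)$ for $A\subseteq B$, $s\notin B$). Agents $1,\dots,n$ have nonempty action sets $X_i\subseteq 2^S$; put $X=X_1\times\dots\times X_n$ and $f(x)=f(x_1\cup\dots\cup x_n)$ for $x\in X$. An ordered graph $G=(V,E)$ on $V=\{1,\dots,n\}$ is a directed graph all of whose edges $(i,j)$ satisfy $i<j$; let $\mathcal N_i=\{j:(j,i)\in E\}$. A greedy solution for $(f,X,G)$ is an $x\in X$ such that, for every $i$, the action $x_i$ maximizes $f\bigl(y\cup\bigcup_{j\in\mathcal N_i}x_j\bigr)$ over $y\in X_i$. The efficiency of $G$ is $$\gamma(G)=\inf_{S,f,X}\ \frac{\min\{f(x): x\text{ a greedy solution for }(f,X,G)\}}{\max_{x\in X}f(x)},$$ the infimum being over all such $S,f,X$ with $\max_{x\in X} f(x)>0$. A complement Turán graph $\overline{T(n,r)}$ is an ordered graph on $\{1,\dots,n\}$ obtained by partitioning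 the nodes into $r$ classes whose sizes differ by at most one and taking as edges all pairs $(i,j)$, $i<j$, of nodes in the same class. Denote by $\hat T(n,m)$ any graph $\overline{T(n,r)}$ with at most $m$ edges for which $r$ is smallest possible. **Theorem 2.** Let $n,m$ be nonnegative integers with $m\le \frac12 n(n-1)$, and let $\mathcal G_{m,n}$ be the set of ordered graphs on $\{1,\dots,n\}$ with at most $m$ edges. (i) If $m\ne\frac12n(n-1)-1$, then a graph $\hat T(n,m)$ exists, and every such graph maximizes $\gamma$ over $\mathcal G_{m,n}$. (ii) If $m=\frac12n(n-1)-1$, then the complete ordered graph on $\{1,\dots,n\}$ minus the edge $(n-1,n)$ is the unique maximizer of $\gamma$ over $\mathcal G_{m,n}$. -/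

import Mathlib

namespace DistributedGreedy

/-- An admissible information graph on the `n` agents `0, …, n-1` (the agents `1, …, n` of the usual
labelling): a set of directed edges `(i, j)`, all of which satisfy `i < j`. -/
@[ext]
structure OrderedGraph (n : ℕ) where
  edges : Finset (Fin n × Fin n)
  lt_of_mem : ∀ e ∈ edges, e.1 < e.2

/-- The set of in-neighbours of agent `i`: the agents whose choices are visible to `i`. -/
def OrderedGraph.inNeighbors {n : ℕ} (G : OrderedGraph n) (i : Fin n) : Finset (Fin n) :=
  Finset.univ.filter fun j => (j, i) ∈ G.edges

/-- A submodular maximization problem for `n` agents over the finite ground set `S`: a normalized,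
monotone, submodular set function `f` (hence nonnegative), and a nonempty action set
`X i ⊆ 2 ^ S` for every agent `i`. -/
structure Problem (n : ℕ) (S : Type) [DecidableEq S] where
  f : Finset S → ℝ
  normalized : f ∅ = 0
  monotone : ∀ A B : Finset S, A ⊆ B → f A ≤ f B
  submodular : ∀ A B : Finset S, A ⊆ B → ∀ s, s ∉ B →
    f (insert s B) - f B ≤ f (insert s A) - f A
  X : Fin n → Finset (Finset S)
  X_nonempty : ∀ i, (X i).Nonempty

section

variable {n : ℕ} {S : Type} [DecidableEq S]

/-- The value `f (x₁ ∪ … ∪ xₙ)` of an action profile. -/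
def Problem.value (P : Problem n S) (x : Fin n → Finset S) : ℝ :=
  P.f (Finset.univ.biUnion x)

/-- `x` is an action profile: each agent uses one of its actions. -/
def Problem.IsProfile (P : Problem n S) (x : Fin n → Finset S) : Prop :=
  ∀ i, x i ∈ P.X i

/-- `x` is a possible outcome of the greedy algorithm on the information graph `G`: each `x i` is an
action of agent `i` that maximizes `f (y ∪ ⋃ j ∈ N i, x j)` over the actions `y` of agent `i`,
where `N i` is the set of in-neighbours of `i`. -/
def Problem.IsGreedySolution (P : Problem n S) (G : OrderedGraph n)
    (x : Fin n → Finset S) : Prop :=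
  P.IsProfile x ∧ ∀ i, ∀ y ∈ P.X i,
    P.f (y ∪ (G.inNeighbors i).biUnion x) ≤ P.f (x i ∪ (G.inNeighbors i).biUnion x)

/-- The optimal value over all action profiles. For finite `S` this is the maximum of a finite
nonempty set of reals. -/
noncomputable def Problem.optValue (P : Problem n S) : ℝ :=
  sSup {v | ∃ x, P.IsProfile x ∧ v = P.value x}

/-- The value of the worst outcome of the greedy algorithm on `G`. For finite `S` this is the
minimum of a finite nonempty set of reals. -/
noncomputable def Problem.worstGreedyValue (P : Problem n S) (G : OrderedGraph n) : ℝ :=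
  sInf {v | ∃ x, P.IsGreedySolution G x ∧ v = P.value x}

end

/-- The efficiency `γ(G)`: the infimum, over all problems (with a finite ground set), of the ratio
of the worst greedy value to the optimal value. Problems of optimal value `0`, for which the ratio
reads `0 / 0`, are left out. -/
noncomputable def efficiency {n : ℕ} (G : OrderedGraph n) : ℝ :=
  sInf {q | ∃ (S : Type) (_ : Fintype S) (_ : DecidableEq S) (P : Problem n S),
    0 < P.optValue ∧ q = P.worstGreedyValue G / P.optValue}

/-- `G` maximizes the efficiency among all admissible graphs on `n` nodes with at most `m` edges. -/
def IsEfficiencyMaximizer {n : ℕ} (m : ℕ) (G : OrderedGraph n) : Prop :=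
  G.edges.card ≤ m ∧ ∀ H : OrderedGraph n, H.edges.card ≤ m → efficiency H ≤ efficiency G

/-- `G` is a complement Turán graph with `r` parts: the nodes are partitioned into `r` classes
whose sizes differ by at most one, and the edges are all pairs inside a class. -/
def IsComplementTuran {n : ℕ} (r : ℕ) (G : OrderedGraph n) : Prop :=
  ∃ c : Fin n → Fin r,
    (∀ a b : Fin r, (Finset.univ.filter fun i => c i = a).card ≤
      (Finset.univ.filter fun i => c i = b).card + 1) ∧
    ∀ i j : Fin n, (i, j) ∈ G.edges ↔ i < j ∧ c i = c j

/-- `G` is a complement Turán graph on `n` nodes with at most `m` edges and with the smallest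
number of parts among all of these. -/
def IsOptimalComplementTuran {n : ℕ} (m : ℕ) (G : OrderedGraph n) : Prop :=
  ∃ r : ℕ, IsComplementTuran r G ∧ G.edges.card ≤ m ∧
    ∀ (r' : ℕ) (H : OrderedGraph n), IsComplementTuran r' H → H.edges.card ≤ m → r ≤ r'

/-- The complete ordered graph without the edge between the last two nodes. -/
def completeMinusLastEdge (n : ℕ) : OrderedGraph n where
  edges := Finset.univ.filter fun e =>
    e.1 < e.2 ∧ ¬ ((e.1 : ℕ) + 2 = n ∧ (e.2 : ℕ) + 1 = n)
  lt_of_mem := fun _ he => (Finset.mem_filter.mp he).2.1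

end DistributedGreedy

/-! Two bounds on γ meet. If the nodes split into r cliques, greedy gains telescope inside each
clique to at most f(x), and submodularity bounds the optimum by f(x) plus all gains; hence γ ≥
1/(r+1) (`le_efficiency_of_isComplementTuran`). Conversely, let I be independent with an outside
agent w that sees a member of I or is seen by none. All of I may pick one common element while the
optimum collects |I|+1 elements, so γ ≤ 1/(|I|+1) (`efficiency_le_of_isExtendable`). Below the edge
count of the graph with s parts, Turán's theorem yields an independent set of size s+1. If no such
set is extendable, it is unique and its members have no outgoing edges; counting then rules this out
for s ≥ 2 and leaves only `completeMinusLastEdge` for s = 1 (`exists_isExtendable_or_eq`). With s+1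
the least feasible number of parts, both bounds equal 1/(s+2). The exceptional graph reaches 1/2,
against at most 1/3 for its competitors when n > 2. -/

namespace DistributedGreedy

open Finset

/-! ### Independent sets and Turán's theorem -/

section Combinatorics

variable {n : ℕ}

/-- Adjacency, disregarding the orientation. -/
def OrderedGraph.Adj (G : OrderedGraph n) (i j : Fin n) : Prop :=
  (i, j) ∈ G.edges ∨ (j, i) ∈ G.edges

instance (G : OrderedGraph n) (i j : Fin n) : Decidable (G.Adj i j) :=
  inferInstanceAs (Decidable (_ ∨ _))

theorem OrderedGraph.Adj.symm {G : OrderedGraph n} {i j : Fin n} (h : G.Adj i j) : G.Adj j i :=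
  Or.symm h

theorem OrderedGraph.lt {G : OrderedGraph n} {i j : Fin n} (h : (i, j) ∈ G.edges) : i < j :=
  G.lt_of_mem _ h

theorem OrderedGraph.not_adj_self (G : OrderedGraph n) (i : Fin n) : ¬ G.Adj i i := by
  rintro (h | h) <;> exact lt_irrefl _ (G.lt h)

/-- A set of agents without edges between its members. -/
def OrderedGraph.IsIndep (G : OrderedGraph n) (I : Finset (Fin n)) : Prop :=
  ∀ i ∈ I, ∀ j ∈ I, (i, j) ∉ G.edges

theorem OrderedGraph.IsIndep.mono {G : OrderedGraph n} {I J : Finset (Fin n)}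
    (h : G.IsIndep I) (hJ : J ⊆ I) : G.IsIndep J :=
  fun i hi j hj => h i (hJ hi) j (hJ hj)

theorem OrderedGraph.IsIndep.insert {G : OrderedGraph n} {I : Finset (Fin n)}
    (h : G.IsIndep I) {v : Fin n} (hv : ∀ i ∈ I, ¬ G.Adj v i) : G.IsIndep (insert v I) := by
  intro i hi j hj hij
  rcases Finset.mem_insert.1 hi with rfl | hi' <;> rcases Finset.mem_insert.1 hj with rfl | hj'
  · exact lt_irrefl _ (G.lt hij)
  · exact hv j hj' (Or.inl hij)
  · exact hv i hi' (Or.inr hij)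
  · exact h i hi' j hj' hij

/-- The edges with both endpoints in `U`. -/
def OrderedGraph.edgesIn (G : OrderedGraph n) (U : Finset (Fin n)) : Finset (Fin n × Fin n) :=
  G.edges.filter fun e => e.1 ∈ U ∧ e.2 ∈ U

theorem OrderedGraph.card_edgesIn_insert (G : OrderedGraph n) {U : Finset (Fin n)} {v : Fin n}
    (hv : v ∉ U) :
    (G.edgesIn U).card + (U.filter (G.Adj v)).card ≤ (G.edgesIn (insert v U)).card := by
  let g : Fin n → Fin n × Fin n := fun j => if (v, j) ∈ G.edges then (v, j) else (j, v)
  have hg : Set.InjOn g (U.filter (G.Adj v)) := by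
    intro a ha b hb hab
    have ha' : a ≠ v := by rintro rfl; simp [hv] at ha
    have hb' : b ≠ v := by rintro rfl; simp [hv] at hb
    simp only [g] at hab
    split_ifs at hab <;> simp_all [Prod.ext_iff]
  rw [← card_image_of_injOn hg, ← card_union_of_disjoint]
  · apply card_le_card
    intro e he
    rcases mem_union.1 he with he | he
    · simp only [OrderedGraph.edgesIn, mem_filter] at he ⊢
      exact ⟨he.1, mem_insert_of_mem he.2.1, mem_insert_of_mem he.2.2⟩
    · obtain ⟨j, hj, rfl⟩ := mem_image.1 he
      obtain ⟨hjU, hj⟩ := mem_filter.1 hj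
      simp only [OrderedGraph.edgesIn, mem_filter, g]
      split_ifs with h
      · exact ⟨h, by simp, by simp [hjU]⟩
      · exact ⟨hj.resolve_left h, by simp [hjU], by simp⟩
  · rw [disjoint_left]
    intro e he he'
    obtain ⟨j, hj, rfl⟩ := mem_image.1 he'
    simp only [OrderedGraph.edgesIn, mem_filter, g] at he
    split_ifs at he
    · exact hv he.2.1
    · exact hv he.2.2

/-- A graph of small maximal degree has a large independent set. -/
theorem OrderedGraph.exists_indep_card_mul_ge (G : OrderedGraph n) (U : Finset (Fin n)) (q : ℕ)
    (hq : ∀ v ∈ U, (U.filter (G.Adj v)).card < q) :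
    ∃ I ⊆ U, G.IsIndep I ∧ U.card ≤ I.card * q := by
  classical
  obtain ⟨I, hI, hmax⟩ := (U.powerset.filter G.IsIndep).exists_max_image card
    ⟨∅, by simp [OrderedGraph.IsIndep]⟩
  obtain ⟨hIU, hI⟩ := mem_filter.1 hI
  rw [mem_powerset] at hIU
  refine ⟨I, hIU, hI, ?_⟩
  -- By maximality of I, the closed neighbourhoods of its members cover U; each has at most q
  -- elements.
  have hcov : U ⊆ I.biUnion fun v => Insert.insert v (U.filter (G.Adj v)) := by
    intro w hw
    by_contra hcon
    simp only [mem_biUnion, mem_insert, mem_filter, not_exists, not_and, not_or] at hcon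
    have hwI : w ∉ I := fun h => (hcon w h).1 rfl
    have hind : G.IsIndep (Insert.insert w I) :=
      hI.insert fun i hi h => (hcon i hi).2 hw h.symm
    have := hmax (Insert.insert w I) (mem_filter.2 ⟨mem_powerset.2 (insert_subset hw hIU), hind⟩)
    rw [card_insert_of_notMem hwI] at this
    omega
  refine (card_le_card hcov).trans (card_biUnion_le_card_mul _ _ _ fun v hv => ?_)
  exact (card_insert_le _ _).trans (hq v (hIU hv))

/-- The number of edges of a complement Turán graph with `s` parts. -/
def turanCount (n s : ℕ) : ℕ := ∑ j ∈ range n, j / s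

/-- Turán's theorem, for independent sets. -/
theorem OrderedGraph.turanCount_le_card_edgesIn (G : OrderedGraph n) (s : ℕ) :
    ∀ (k : ℕ) (U : Finset (Fin n)), U.card = k → (∀ I ⊆ U, G.IsIndep I → I.card ≤ s) →
      turanCount k s ≤ (G.edgesIn U).card := by
  intro k
  induction k with
  | zero => intro U _ _; simp [turanCount]
  | succ k ih =>
    intro U hU hI
    -- Otherwise some independent I has k + 1 ≤ |I| * (k / s) ≤ s * (k / s) ≤ k. Deleting v then
    -- removes at least k / s edges, the last summand of `turanCount (k + 1) s`.
    obtain ⟨v, hv, hdeg⟩ : ∃ v ∈ U, k / s ≤ (U.filter (G.Adj v)).card := by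
      by_contra! hcon
      obtain ⟨I, hIU, hind, hc⟩ := G.exists_indep_card_mul_ge U _ hcon
      have h1 := Nat.mul_le_mul_right (k / s) (hI I hIU hind)
      have h2 := Nat.mul_div_le k s
      omega
    have h1 := ih (U.erase v) (by rw [card_erase_of_mem hv, hU]; rfl)
      fun I hIU => hI I (hIU.trans (erase_subset _ _))
    have h2 := G.card_edgesIn_insert (notMem_erase v U)
    rw [insert_erase hv] at h2
    have h3 : ((U.erase v).filter (G.Adj v)) = U.filter (G.Adj v) := by
      ext j
      simp only [mem_filter, mem_erase]
      refine ⟨fun h => ⟨h.1.2, h.2⟩, fun h => ⟨⟨?_, h.1⟩, h.2⟩⟩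
      rintro rfl
      exact G.not_adj_self _ h.2
    rw [h3] at h2
    rw [turanCount, sum_range_succ]
    change turanCount k s + _ ≤ _
    omega

theorem OrderedGraph.edgesIn_univ (G : OrderedGraph n) : G.edgesIn univ = G.edges := by
  simp [OrderedGraph.edgesIn]

/-! ### Edge counts of the extremal graphs -/

theorem card_filter_fin_eq_count (N : ℕ) (p : ℕ → Prop) [DecidablePred p] :
    (univ.filter fun i : Fin N => p i).card = Nat.count p N := by
  rw [card_filter, Fin.sum_univ_eq_sum_range (fun i => if p i then 1 else 0), ← card_filter,
    Nat.count_eq_card_filter_range]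

/-- The complement Turán graph whose classes are the residue classes modulo `s`. -/
def complementTuran (n s : ℕ) : OrderedGraph n where
  edges := univ.filter fun e => e.1 < e.2 ∧ (e.1 : ℕ) % s = (e.2 : ℕ) % s
  lt_of_mem := fun _ he => (mem_filter.mp he).2.1

theorem isComplementTuran_complementTuran (n : ℕ) {s : ℕ} (hs : 0 < s) :
    IsComplementTuran s (complementTuran n s) := by
  refine ⟨fun i => ⟨i % s, Nat.mod_lt _ hs⟩, fun a b => ?_, fun i j => ?_⟩
  · have key : ∀ a : Fin s, (univ.filter fun i : Fin n =>
        (⟨i % s, Nat.mod_lt _ hs⟩ : Fin s) = a).card = n / s + if (a : ℕ) % s < n % s then 1 else 0 := by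
      intro a
      rw [← Nat.count_modEq_card n hs a, ← card_filter_fin_eq_count]
      congr 1
      ext i
      simp [Fin.ext_iff, Nat.ModEq, Nat.mod_eq_of_lt a.2]
    rw [key, key]
    split_ifs <;> omega
  · simp [complementTuran, Fin.ext_iff]

theorem card_edges_complementTuran (n : ℕ) {s : ℕ} (hs : 0 < s) :
    (complementTuran n s).edges.card = turanCount n s := by
  rw [complementTuran, card_filter, Fintype.sum_prod_type_right, turanCount,
    ← Fin.sum_univ_eq_sum_range]
  refine sum_congr rfl fun j _ => ?_
  simp only [Fin.lt_def]
  rw [Fin.sum_univ_eq_sum_range (fun i => if i < (j : ℕ) ∧ i % s = (j : ℕ) % s then 1 else 0) n,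
    ← card_filter]
  have : ((range n).filter fun i => i < (j : ℕ) ∧ i % s = j % s)
      = (range j).filter fun i => i ≡ j [MOD s] := by
    ext i
    rw [mem_filter, mem_filter, mem_range, mem_range]
    exact ⟨fun h => h.2, fun h => ⟨h.1.trans j.2, h⟩⟩
  simp only [this]
  rw [← Nat.count_eq_card_filter_range, Nat.count_modEq_card _ hs]
  simp

theorem turanCount_one (n : ℕ) : turanCount n 1 = n * (n - 1) / 2 := by
  simp [turanCount, sum_range_id]

theorem card_edges_completeMinusLastEdge (n : ℕ) (hn : 2 ≤ n) :
    (completeMinusLastEdge n).edges.card + 1 = n * (n - 1) / 2 := by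
  obtain ⟨k, rfl⟩ := Nat.exists_eq_add_of_le' hn
  have h : (⟨k, by omega⟩, ⟨k + 1, by omega⟩) ∉ (completeMinusLastEdge (k + 2)).edges := by
    simp [completeMinusLastEdge]
  rw [← turanCount_one, ← card_edges_complementTuran _ one_pos, ← card_insert_of_notMem h]
  congr 1
  ext ⟨i, j⟩
  simp only [completeMinusLastEdge, complementTuran, mem_insert, mem_filter, mem_univ, true_and,
    Prod.ext_iff, Fin.ext_iff, Fin.lt_def, Nat.mod_one, and_true]
  omega

/-! ### Graphs without extendable independent sets -/

/-- An independent set `I` with an agent `w` outside it that either sees a member of `I`, or is seen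
by no member of `I`. -/
def OrderedGraph.IsExtendable (G : OrderedGraph n) (I : Finset (Fin n)) (w : Fin n) : Prop :=
  G.IsIndep I ∧ w ∉ I ∧ ((∃ i ∈ I, (i, w) ∈ G.edges) ∨ ∀ i ∈ I, (w, i) ∉ G.edges)

theorem OrderedGraph.no_edge_of_not_isExtendable {G : OrderedGraph n} {k : ℕ}
    (hno : ∀ I w, I.card = k → ¬ G.IsExtendable I w) {I : Finset (Fin n)} (hI : G.IsIndep I)
    (hk : I.card = k) {v w : Fin n} (hv : v ∈ I) : (v, w) ∉ G.edges := fun h =>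
  hno I w hk ⟨hI, fun hw => hI v hv w hw h, Or.inl ⟨v, hv, h⟩⟩

theorem OrderedGraph.exists_edge_of_not_isExtendable {G : OrderedGraph n} {k : ℕ}
    (hno : ∀ I w, I.card = k → ¬ G.IsExtendable I w) {I : Finset (Fin n)} (hI : G.IsIndep I)
    (hk : I.card = k) {w : Fin n} (hw : w ∉ I) : ∃ v ∈ I, (w, v) ∈ G.edges := by
  by_contra! hcon
  exact hno I w hk ⟨hI, hw, Or.inr hcon⟩

/-- Every outside agent has two neighbours in a non-extendable independent set. -/
theorem OrderedGraph.two_le_card_of_not_isExtendable {G : OrderedGraph n} {k : ℕ}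
    (hno : ∀ I w, I.card = k → ¬ G.IsExtendable I w) {I : Finset (Fin n)} (hI : G.IsIndep I)
    (hk : I.card = k) {w : Fin n} (hw : w ∉ I) : 2 ≤ (I.filter fun v => G.Adj v w).card := by
  obtain ⟨v, hv, hwv⟩ := G.exists_edge_of_not_isExtendable hno hI hk hw
  by_contra! hlt
  have hsub : ∀ u ∈ I, G.Adj u w → u = v := fun u hu huw =>
    card_le_one.1 (Nat.lt_succ_iff.1 hlt) u (mem_filter.2 ⟨hu, huw⟩) v
      (mem_filter.2 ⟨hv, Or.inr hwv⟩)
  -- If v is the only neighbour of w in I, swapping v for w gives another independent k-set, and v,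
  -- which sees w, extends it.
  have hI' : G.IsIndep (Insert.insert w (I.erase v)) :=
    (hI.mono (erase_subset _ _)).insert fun u hu h =>
      (mem_erase.1 hu).1 (hsub u (mem_erase.1 hu).2 h.symm)
  refine G.no_edge_of_not_isExtendable hno hI' ?_ (mem_insert_self _ _) hwv
  rw [card_insert_of_notMem (fun h => hw (mem_erase.1 h).2), card_erase_add_one hv, hk]

/-- If no independent set of size `k` is extendable, there is at most one. -/
theorem OrderedGraph.eq_of_not_isExtendable {G : OrderedGraph n} {k : ℕ}
    (hno : ∀ I w, I.card = k → ¬ G.IsExtendable I w) {I J : Finset (Fin n)} (hI : G.IsIndep I)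
    (hk : I.card = k) (hJ : G.IsIndep J) (hJk : J.card = k) : I = J := by
  refine eq_of_subset_of_card_le (fun v hv => ?_) (by omega)
  by_contra hvJ
  -- An agent of I outside J would need an outgoing edge into J, but members of I have none.
  obtain ⟨u, _, hvu⟩ := G.exists_edge_of_not_isExtendable hno hJ hJk hvJ
  exact G.no_edge_of_not_isExtendable hno hI hk hv hvu

theorem OrderedGraph.card_le_of_not_isExtendable {G : OrderedGraph n} {k : ℕ}
    (hno : ∀ I w, I.card = k + 1 → ¬ G.IsExtendable I w) {I : Finset (Fin n)} (hI : G.IsIndep I)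
    (hk : I.card = k + 1) {v : Fin n} (hv : v ∈ I) {J : Finset (Fin n)} (hJ : G.IsIndep J)
    (hvJ : v ∉ J) : J.card ≤ k := by
  by_contra! hlt
  obtain ⟨J', hJJ, hJ'⟩ := exists_subset_card_eq hlt
  have := G.eq_of_not_isExtendable hno hI hk (hJ.mono hJJ) hJ'
  exact hvJ (hJJ (this ▸ hv))

/-- Removing a member v of I destroys the only independent set of size s + 1, so Turán's theorem
applies to the remaining n - 1 nodes. A v of degree at least (n - 1) / s supplies the missing
summand. -/
theorem OrderedGraph.turanCount_le_of_not_isExtendable {G : OrderedGraph n} {s : ℕ} (hs : 2 ≤ s)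
    (hn : s + 1 < n) (hno : ∀ I w, I.card = s + 1 → ¬ G.IsExtendable I w) {I : Finset (Fin n)}
    (hI : G.IsIndep I) (hk : I.card = s + 1) : turanCount n s ≤ G.edges.card := by
  obtain ⟨v, hv, hdeg⟩ : ∃ v ∈ I, (n - 1) / s ≤ ((univ.erase v).filter (G.Adj v)).card := by
    -- Double count edges between I and its complement: each outside agent has two neighbours in I,
    -- so small degrees force 2(n - s - 1) + (s + 1) ≤ (s + 1)d with d = (n - 1) / s. This
    -- contradicts sd ≤ n - 1 once s ≥ 2.
    by_contra! hcon
    have h1 : ∀ v ∈ I, (Iᶜ.filter (G.Adj v)).card + 1 ≤ (n - 1) / s := fun v hv =>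
      lt_of_le_of_lt (card_le_card (filter_subset_filter _ fun w hw =>
        mem_erase.2 ⟨fun h => mem_compl.1 hw (h ▸ hv), mem_univ _⟩)) (hcon v hv)
    have h2 : ∑ v ∈ I, (Iᶜ.filter (G.Adj v)).card
        = ∑ w ∈ Iᶜ, (I.filter fun v => G.Adj v w).card :=
      sum_card_bipartiteAbove_eq_sum_card_bipartiteBelow _
    have h3 : Iᶜ.card * 2 ≤ ∑ w ∈ Iᶜ, (I.filter fun v => G.Adj v w).card :=
      card_nsmul_le_sum _ _ _ fun w hw =>
        G.two_le_card_of_not_isExtendable hno hI hk (mem_compl.1 hw)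
    have h4 : ∑ v ∈ I, ((Iᶜ.filter (G.Adj v)).card + 1) ≤ I.card * ((n - 1) / s) :=
      sum_le_card_nsmul _ _ _ h1
    rw [sum_add_distrib, h2, sum_const, smul_eq_mul, mul_one, hk] at h4
    rw [card_compl, Fintype.card_fin, hk] at h3
    have h5 := Nat.mul_div_le (n - 1) s
    generalize (n - 1) / s = d at *
    generalize ∑ w ∈ Iᶜ, (I.filter fun v => G.Adj v w).card = A at *
    obtain ⟨l, rfl⟩ := Nat.exists_eq_add_of_le hn
    obtain ⟨t, rfl⟩ := Nat.exists_eq_add_of_le hs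
    have h6 : (l + 1) * 2 ≤ A := by omega
    have h7 : (2 + t) * d ≤ t + 3 + l := by omega
    obtain _ | e := d
    · omega
    · nlinarith [Nat.zero_le (t * e)]
  have h1 := G.turanCount_le_card_edgesIn s (n - 1) (univ.erase v)
    (by rw [card_erase_of_mem (mem_univ _), card_univ, Fintype.card_fin])
    fun J hJU hJ => G.card_le_of_not_isExtendable hno hI hk hv hJ fun h => by
      simpa using hJU h
  have h2 := G.card_edgesIn_insert (notMem_erase v univ)
  rw [insert_erase (mem_univ _), G.edgesIn_univ] at h2
  obtain ⟨l, rfl⟩ : ∃ l, n = l + 1 := ⟨n - 1, by omega⟩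
  rw [turanCount, sum_range_succ]
  change turanCount l s + _ ≤ _
  simp only [Nat.add_sub_cancel] at *
  omega

/-- Uniqueness makes I the only nonadjacent pair; since its members have no outgoing edges, every
other node precedes them. -/
theorem OrderedGraph.eq_completeMinusLastEdge_of_not_isExtendable {G : OrderedGraph n} (hn : 2 < n)
    (hno : ∀ I w, I.card = 2 → ¬ G.IsExtendable I w) {I : Finset (Fin n)}
    (hI : G.IsIndep I) (hk : I.card = 2) : G = completeMinusLastEdge n := by
  have hadj : ∀ u v, u < v → ({u, v} : Finset (Fin n)) ≠ I → (u, v) ∈ G.edges := by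
    intro u v huv hne
    by_contra hcon
    refine hne (G.eq_of_not_isExtendable hno hI hk (J := {u, v}) ?_ (card_pair huv.ne)).symm
    intro i hi j hj hij
    have := G.lt hij
    simp only [mem_insert, mem_singleton] at hi hj
    rcases hi with rfl | rfl <;> rcases hj with rfl | rfl <;>
      first | exact hcon hij | order
  have hlt : ∀ u v, u ∉ I → v ∈ I → u < v := by
    intro u v hu hv
    by_contra! hvu
    have hne : v ≠ u := fun h => hu (h ▸ hv)
    refine G.no_edge_of_not_isExtendable hno hI hk hv (hadj v u (lt_of_le_of_ne hvu hne) ?_)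
    rintro rfl
    simp at hu
  obtain ⟨a, b, hab, rfl⟩ : ∃ a b, a < b ∧ I = {a, b} := by
    obtain ⟨a, b, hab, rfl⟩ := card_eq_two.1 hk
    rcases lt_or_gt_of_ne hab with h | h
    · exact ⟨a, b, h, rfl⟩
    · exact ⟨b, a, h, pair_comm _ _⟩
  have hb : (b : ℕ) + 1 = n := by
    by_contra hb
    have h : (⟨n - 1, by omega⟩ : Fin n) ∉ ({a, b} : Finset (Fin n)) := by
      simp only [mem_insert, mem_singleton, Fin.ext_iff]
      omega
    have := hlt _ b h (by simp)
    simp only [Fin.lt_def] at this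
    omega
  have ha : (a : ℕ) + 2 = n := by
    by_contra ha
    have h : (⟨n - 2, by omega⟩ : Fin n) ∉ ({a, b} : Finset (Fin n)) := by
      simp only [mem_insert, mem_singleton, Fin.ext_iff]
      omega
    have := hlt _ a h (by simp)
    simp only [Fin.lt_def] at this hab
    omega
  ext ⟨u, v⟩
  simp only [completeMinusLastEdge, mem_filter, mem_univ, true_and]
  constructor
  · intro h
    refine ⟨G.lt h, fun huv => ?_⟩
    obtain rfl : u = a := Fin.ext (by omega)
    obtain rfl : v = b := Fin.ext (by omega)
    exact hI _ (by simp) _ (by simp) h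
  · rintro ⟨huv, hne⟩
    refine hadj u v huv fun h => hne ?_
    have hu : u ∈ ({a, b} : Finset (Fin n)) := h ▸ by simp
    have hv : v ∈ ({a, b} : Finset (Fin n)) := h ▸ by simp
    simp only [mem_insert, mem_singleton, Fin.ext_iff] at hu hv
    simp only [Fin.lt_def] at huv
    omega

theorem OrderedGraph.exists_isExtendable_or_eq {G : OrderedGraph n} {s : ℕ} (hs : 1 ≤ s)
    (hn : s + 1 < n) (hG : G.edges.card < turanCount n s) :
    (∃ I w, G.IsExtendable I w ∧ I.card = s + 1) ∨ G = completeMinusLastEdge n := by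
  obtain ⟨J, hJ, hJs⟩ : ∃ J, G.IsIndep J ∧ s < J.card := by
    by_contra! hcon
    have := G.turanCount_le_card_edgesIn s n univ (by simp) fun I _ => hcon I
    rw [G.edgesIn_univ] at this
    omega
  obtain ⟨I, hIJ, hI⟩ := exists_subset_card_eq (Nat.succ_le_of_lt hJs)
  refine or_iff_not_imp_left.2 fun hno => ?_
  have hno' : ∀ I w, I.card = s + 1 → ¬ G.IsExtendable I w := fun I w hc h => hno ⟨I, w, h, hc⟩
  rcases hs.eq_or_lt with rfl | hs
  · exact G.eq_completeMinusLastEdge_of_not_isExtendable hn hno' (hJ.mono hIJ) hI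
  · exact absurd (G.turanCount_le_of_not_isExtendable hs hn hno' (hJ.mono hIJ) hI) (by omega)

end Combinatorics

/-! ### Submodular inequalities and greedy solutions -/

section Efficiency

variable {n : ℕ} {S : Type} [DecidableEq S]

namespace Problem

variable (P : Problem n S)

theorem f_nonneg (A : Finset S) : 0 ≤ P.f A :=
  P.normalized ▸ P.monotone ∅ A (empty_subset A)

theorem value_nonneg (x : Fin n → Finset S) : 0 ≤ P.value x := P.f_nonneg _

/-- Submodularity for the marginal value of a set. -/
theorem submodular_union (C : Finset S) :
    ∀ A B : Finset S, A ⊆ B → P.f (C ∪ B) - P.f B ≤ P.f (C ∪ A) - P.f A := by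
  induction C using Finset.induction_on with
  | empty => intro A B _; simp
  | insert s C _ ih =>
    intro A B hAB
    have h1 := ih A B hAB
    rw [insert_union, insert_union]
    -- The axiom needs s outside the larger set; if s lies in it, its marginal there is 0 and
    -- monotonicity suffices.
    by_cases hs : s ∈ C ∪ B
    · rw [insert_eq_of_mem hs]
      have := P.monotone _ _ (subset_insert s (C ∪ A))
      linarith
    · have := P.submodular (C ∪ A) (C ∪ B) (union_subset_union_right hAB) s hs
      linarith

theorem f_biUnion_union_le {ι : Type*} [DecidableEq ι] (T : Finset ι) (y : ι → Finset S)
    (B : Finset S) : P.f (T.biUnion y ∪ B) ≤ P.f B + ∑ i ∈ T, (P.f (y i ∪ B) - P.f B) := by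
  induction T using Finset.induction_on with
  | empty => simp
  | insert a T ha ih =>
    rw [biUnion_insert, sum_insert ha, union_assoc]
    have := P.submodular_union (y a) B (T.biUnion y ∪ B) subset_union_right
    linarith

/-- The marginal value that agent `i` sees in its own choice. -/
def gain (G : OrderedGraph n) (x : Fin n → Finset S) (i : Fin n) : ℝ :=
  P.f (x i ∪ (G.inNeighbors i).biUnion x) - P.f ((G.inNeighbors i).biUnion x)

/-- By submodularity the marginal of y i over the choices of T is at most its marginal over what i
sees, which greediness bounds by the gain of x i. Keeping T free allows a smaller base term than the
full value. -/
theorem value_le_of_isGreedySolution {G : OrderedGraph n} {x y : Fin n → Finset S}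
    (hx : P.IsGreedySolution G x) (hy : P.IsProfile y) (T : Finset (Fin n))
    (hT : ∀ i, G.inNeighbors i ⊆ T) :
    P.value y ≤ P.f (T.biUnion x) + ∑ i, P.gain G x i := by
  refine (P.monotone _ _ subset_union_left).trans
    ((P.f_biUnion_union_le univ y (T.biUnion x)).trans ?_)
  gcongr with i
  have h1 := P.submodular_union (y i) _ _ (biUnion_subset_biUnion_of_subset_left x (hT i))
  have h2 := hx.2 i (y i) (hy i)
  unfold gain
  linarith

/-- Within C each agent sees exactly its predecessors, so the gains telescope. -/
theorem sum_gain_eq {G : OrderedGraph n} (x : Fin n → Finset S) (C : Finset (Fin n)) :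
    (∀ i ∈ C, G.inNeighbors i = C.filter (· < i)) →
      ∑ i ∈ C, P.gain G x i = P.f (C.biUnion x) := by
  intro hC
  have key : ∀ D : Finset (Fin n),
      ∑ i ∈ D, (P.f (x i ∪ (D.filter (· < i)).biUnion x) - P.f ((D.filter (· < i)).biUnion x))
        = P.f (D.biUnion x) := by
    intro D
    induction D using Finset.induction_on_max with
    | empty => simp [P.normalized]
    | insert a D hD ih =>
      have ha : a ∉ D := fun h => lt_irrefl _ (hD a h)
      have h1 : (insert a D).filter (· < a) = D := by
        ext i
        simp only [mem_filter, mem_insert]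
        refine ⟨fun h => h.1.resolve_left h.2.ne, fun h => ⟨Or.inr h, hD i h⟩⟩
      have h2 : ∀ i ∈ D, (insert a D).filter (· < i) = D.filter (· < i) := by
        intro i hi
        rw [filter_insert, if_neg (hD i hi).not_gt]
      rw [sum_insert ha, h1, biUnion_insert, sum_congr rfl fun i hi => by rw [h2 i hi], ih]
      ring
  rw [← key C]
  exact sum_congr rfl fun i hi => by rw [gain, hC i hi]

theorem exists_isProfile : ∃ x, P.IsProfile x :=
  ⟨fun i => (P.X_nonempty i).choose, fun i => (P.X_nonempty i).choose_spec⟩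

theorem exists_isGreedySolution (G : OrderedGraph n) : ∃ x, P.IsGreedySolution G x := by
  suffices h : ∀ k : ℕ, ∃ x, P.IsProfile x ∧ ∀ i : Fin n, (i : ℕ) < k → ∀ y ∈ P.X i,
      P.f (y ∪ (G.inNeighbors i).biUnion x) ≤ P.f (x i ∪ (G.inNeighbors i).biUnion x) by
    obtain ⟨x, hx, h⟩ := h n
    exact ⟨x, hx, fun i => h i i.2⟩
  intro k
  induction k with
  | zero =>
    obtain ⟨x, hx⟩ := P.exists_isProfile
    exact ⟨x, hx, fun i hi => absurd hi (Nat.not_lt_zero _)⟩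
  | succ k ih =>
    obtain ⟨x, hx, hg⟩ := ih
    by_cases hk : k < n
    · let a : Fin n := ⟨k, hk⟩
      obtain ⟨z, hz, hmax⟩ := (P.X a).exists_max_image
        (fun y => P.f (y ∪ (G.inNeighbors a).biUnion x)) (P.X_nonempty a)
      -- Edges point forward, so changing the action of agent k affects nothing that agents up to k
      -- see.
      have hcongr : ∀ i : Fin n, (i : ℕ) < k + 1 →
          (G.inNeighbors i).biUnion (Function.update x a z) = (G.inNeighbors i).biUnion x := by
        intro i hi
        refine biUnion_congr rfl fun j hj => Function.update_of_ne ?_ _ _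
        rintro rfl
        have := G.lt (mem_filter.1 hj).2
        simp only [Fin.lt_def, a] at this
        omega
      refine ⟨Function.update x a z, fun i => ?_, fun i hi => ?_⟩
      · rcases eq_or_ne i a with rfl | h
        · simpa using hz
        · simpa [h] using hx i
      · rw [hcongr i hi]
        rcases eq_or_ne i a with rfl | h
        · simpa using hmax
        · rw [Function.update_of_ne h]
          refine hg i (lt_of_le_of_ne (Nat.lt_succ_iff.1 hi) fun h' => h (Fin.ext h'))
    · exact ⟨x, hx, fun i _ => hg i (i.2.trans_le (not_lt.1 hk))⟩

theorem worstGreedyValue_nonneg (G : OrderedGraph n) : 0 ≤ P.worstGreedyValue G := by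
  refine Real.sInf_nonneg ?_
  rintro _ ⟨x, _, rfl⟩
  exact P.value_nonneg x

theorem worstGreedyValue_le {G : OrderedGraph n} {x : Fin n → Finset S}
    (hx : P.IsGreedySolution G x) : P.worstGreedyValue G ≤ P.value x := by
  refine csInf_le ⟨0, ?_⟩ ⟨x, hx, rfl⟩
  rintro _ ⟨x, _, rfl⟩
  exact P.value_nonneg x

theorem value_le_optValue [Fintype S] {x : Fin n → Finset S} (hx : P.IsProfile x) :
    P.value x ≤ P.optValue := by
  refine le_csSup ⟨P.f univ, ?_⟩ ⟨x, hx, rfl⟩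
  rintro _ ⟨x, _, rfl⟩
  exact P.monotone _ _ (subset_univ _)

end Problem

theorem efficiency_le [Fintype S] (G : OrderedGraph n) (P : Problem n S) (h : 0 < P.optValue) :
    efficiency G ≤ P.worstGreedyValue G / P.optValue := by
  refine csInf_le ⟨0, ?_⟩ ⟨S, inferInstance, inferInstance, P, h, rfl⟩
  rintro _ ⟨S, _, _, P, h, rfl⟩
  exact div_nonneg (P.worstGreedyValue_nonneg G) h.le

/-! ### Upper bounds from the common element problem -/

/-- The problem in which the members of `I` choose between a common element and a private one, agent
`w` may choose the common element, and the value counts elements. -/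
def commonElementProblem (I : Finset (Fin n)) (w : Fin n) : Problem n (Option (Fin n)) where
  f A := A.card
  normalized := by simp
  monotone A B h := by exact_mod_cast card_le_card h
  submodular A B h s hs := by
    rw [card_insert_of_notMem hs, card_insert_of_notMem fun h' => hs (h h')]
    simp
  X i := if i ∈ I then {{none}, {some i}} else if i = w then {{none}, ∅} else {∅}
  X_nonempty i := by split_ifs <;> simp

theorem exists_problem_of_isExtendable {G : OrderedGraph n} {I : Finset (Fin n)} {w : Fin n}
    (h : G.IsExtendable I w) : ∃ P : Problem n (Option (Fin n)),
      0 < P.optValue ∧ P.worstGreedyValue G / P.optValue ≤ 1 / ((I.card : ℝ) + 1) := by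
  classical
  obtain ⟨hI, hw, hor⟩ := h
  have hpos : (0 : ℝ) < (I.card : ℝ) + 1 := by positivity
  let P := commonElementProblem I w
  let y : Fin n → Finset (Option (Fin n)) := fun i =>
    if i ∈ I then {some i} else if i = w then {none} else ∅
  have hy : P.IsProfile y := by
    intro i
    simp only [P, commonElementProblem, y]
    split_ifs <;> simp
  have hyv : (I.card : ℝ) + 1 ≤ P.value y := by
    have : insert none (I.image some) ⊆ univ.biUnion y := by
      intro a ha
      rw [mem_biUnion]
      rcases mem_insert.1 ha with rfl | ha
      · exact ⟨w, mem_univ _, by simp [y, hw]⟩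
      · obtain ⟨i, hi, rfl⟩ := mem_image.1 ha
        exact ⟨i, mem_univ _, by simp [y, hi]⟩
    have := card_le_card this
    rw [card_insert_of_notMem (by simp), card_image_of_injective _ (Option.some_injective _)] at this
    simp only [Problem.value, P, commonElementProblem]
    exact_mod_cast this
  have hopt := hyv.trans (P.value_le_optValue hy)
  -- If w sees I, the common element is already taken and w may choose ∅; otherwise w takes it too,
  -- unseen by I.
  let x : Fin n → Finset (Option (Fin n)) := fun i =>
    if i ∈ I then {none} else if i = w ∧ ¬ ∃ j ∈ I, (j, w) ∈ G.edges then {none} else ∅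
  have hx : P.IsGreedySolution G x := by
    refine ⟨fun i => ?_, fun i z hz => ?_⟩
    · simp only [P, commonElementProblem, x]
      split_ifs <;> simp_all
    · simp only [P, commonElementProblem, Nat.cast_le] at hz ⊢
      by_cases hi : i ∈ I
      -- A member of I sees only empty choices, so its two singletons tie.
      · have hN : (G.inNeighbors i).biUnion x = ∅ := by
          refine subset_empty.1 (biUnion_subset.2 fun j hj => subset_empty.2 ?_)
          have hj := (mem_filter.1 hj).2
          have hjI : j ∉ I := fun h => hI j h i hi hj
          simp only [x, if_neg hjI, ite_eq_right_iff, and_imp]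
          rintro rfl hcon
          exact absurd hj (hor.resolve_left hcon i hi)
        rw [hN]
        simp only [hi, if_true, mem_insert, mem_singleton] at hz
        rcases hz with rfl | rfl <;> simp [x, hi]
      · rw [if_neg hi] at hz
        split_ifs at hz with hiw
        · subst hiw
          simp only [mem_insert, mem_singleton] at hz
          by_cases hex : ∃ j ∈ I, (j, i) ∈ G.edges
          · obtain ⟨j, hj, hji⟩ := id hex
            have hmem : none ∈ (G.inNeighbors i).biUnion x :=
              mem_biUnion.2 ⟨j, by simpa [OrderedGraph.inNeighbors] using hji, by simp [x, hj]⟩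
            refine card_le_card (union_subset ?_ subset_union_right)
            rcases hz with rfl | rfl
            · exact singleton_subset_iff.2 (mem_union_right _ hmem)
            · exact empty_subset _
          · have : x i = {none} := by simp only [x]; rw [if_neg hi, if_pos (by simpa using hex)]
            rw [this]
            refine card_le_card (union_subset_union_left ?_)
            rcases hz with rfl | rfl <;> simp
        · rw [mem_singleton.1 hz]
          exact card_le_card (union_subset_union_left (empty_subset _))
  have hxv : P.value x ≤ 1 := by
    have : univ.biUnion x ⊆ {none} := by
      refine biUnion_subset.2 fun i _ => ?_
      simp only [x]
      split_ifs <;> simp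
    have := card_le_card this
    simp only [Problem.value, P, commonElementProblem]
    exact_mod_cast this
  refine ⟨P, hpos.trans_le hopt, ?_⟩
  exact div_le_div₀ zero_le_one ((P.worstGreedyValue_le hx).trans hxv) hpos hopt

theorem efficiency_le_of_isExtendable {G : OrderedGraph n} {I : Finset (Fin n)} {w : Fin n}
    (h : G.IsExtendable I w) : efficiency G ≤ 1 / ((I.card : ℝ) + 1) := by
  obtain ⟨P, hP, hle⟩ := exists_problem_of_isExtendable h
  exact (efficiency_le G P hP).trans hle

/-- Caps γ at 1/2 for every graph with n ≥ 2, and supplies a problem with positive optimum. -/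
theorem OrderedGraph.isExtendable_singleton (G : OrderedGraph n) {i j : Fin n} (hij : i < j) :
    G.IsExtendable {i} j := by
  refine ⟨?_, by simpa using hij.ne', Or.inr ?_⟩
  · simpa [OrderedGraph.IsIndep] using fun h => lt_irrefl _ (G.lt h)
  · simpa using fun h => lt_asymm hij (G.lt h)

/-! ### Lower bounds on the efficiency -/

theorem le_efficiency {G : OrderedGraph n} (hn : 2 ≤ n) {c : ℝ} (hc : 0 < c)
    (h : ∀ (S : Type) [DecidableEq S] (P : Problem n S) (x y : Fin n → Finset S),
      P.IsGreedySolution G x → P.IsProfile y → P.value y ≤ c * P.value x) :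
    1 / c ≤ efficiency G := by
  refine le_csInf ?_ ?_
  -- The infimum must range over a nonempty set, as `sInf ∅ = 0` for reals.
  · obtain ⟨P, hP, -⟩ := exists_problem_of_isExtendable
      (G.isExtendable_singleton (i := ⟨0, by omega⟩) (j := ⟨1, by omega⟩) (by simp [Fin.lt_def]))
    exact ⟨_, _, inferInstance, inferInstance, P, hP, rfl⟩
  · rintro _ ⟨S, _, _, P, hP, rfl⟩
    rw [div_le_div_iff₀ hc hP, one_mul, mul_comm, ← div_le_iff₀' hc]
    obtain ⟨x₀, hx₀⟩ := P.exists_isGreedySolution G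
    refine le_csInf ⟨_, x₀, hx₀, rfl⟩ ?_
    rintro _ ⟨x, hx, rfl⟩
    rw [div_le_iff₀' hc]
    obtain ⟨y₀, hy₀⟩ := P.exists_isProfile
    refine csSup_le ⟨_, y₀, hy₀, rfl⟩ ?_
    rintro _ ⟨y, hy, rfl⟩
    exact h S P x y hx hy

theorem le_efficiency_of_isComplementTuran {G : OrderedGraph n} (hn : 2 ≤ n) {r : ℕ}
    (hG : IsComplementTuran r G) : 1 / ((r : ℝ) + 1) ≤ efficiency G := by
  obtain ⟨c, -, hc⟩ := hG
  refine le_efficiency hn (by positivity) fun S _ P x y hx hy => ?_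
  have h1 := P.value_le_of_isGreedySolution hx hy univ fun i => subset_univ _
  have h2 : ∑ i, P.gain G x i ≤ r * P.value x := by
    rw [← sum_fiberwise univ c, ← nsmul_eq_mul]
    refine (sum_le_card_nsmul _ _ (P.value x) fun a _ => ?_).trans_eq (by simp)
    rw [P.sum_gain_eq x]
    · exact P.monotone _ _ (biUnion_subset_biUnion_of_subset_left x (subset_univ _))
    · intro i hi
      ext j
      simp only [mem_filter, mem_univ, true_and, OrderedGraph.inNeighbors, hc] at hi ⊢
      rw [hi, and_comm]
  change _ ≤ P.value x + _ at h1
  linarith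

/-- With T all but the last two agents, gains in T sum to f(T), and the last two, both seeing
exactly T, gain at most f(x) - f(T) each. The bound becomes 2 f(T) + 2 (f(x) - f(T)) = 2 f(x). -/
theorem half_le_efficiency_completeMinusLastEdge (hn : 2 ≤ n) :
    1 / 2 ≤ efficiency (completeMinusLastEdge n) := by
  refine le_efficiency hn two_pos fun S _ P x y hx hy => ?_
  obtain ⟨k, rfl⟩ := Nat.exists_eq_add_of_le' hn
  let a : Fin (k + 2) := ⟨k, by omega⟩
  let b : Fin (k + 2) := ⟨k + 1, by omega⟩
  let T : Finset (Fin (k + 2)) := univ.filter fun i => (i : ℕ) < k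
  have hN : ∀ i ∈ T, (completeMinusLastEdge (k + 2)).inNeighbors i = T.filter (· < i) := by
    intro i hi
    ext j
    simp only [T, OrderedGraph.inNeighbors, completeMinusLastEdge, mem_filter, mem_univ, true_and,
      Fin.lt_def] at hi ⊢
    omega
  have hNT : ∀ i : Fin (k + 2), k ≤ (i : ℕ) → (completeMinusLastEdge (k + 2)).inNeighbors i = T := by
    intro i hi
    ext j
    simp only [T, OrderedGraph.inNeighbors, completeMinusLastEdge, mem_filter, mem_univ, true_and,
      Fin.lt_def]
    omega
  have h1 := P.value_le_of_isGreedySolution hx hy T fun i => by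
    rcases lt_or_ge (i : ℕ) k with hi | hi
    · exact (hN i (by simpa [T] using hi)).trans_subset (filter_subset _ _)
    · exact (hNT i hi).subset
  have haT : a ∉ insert b T := by simp [a, b, T, Fin.ext_iff]
  have hbT : b ∉ T := by simp [b, T]
  have huniv : (univ : Finset (Fin (k + 2))) = insert a (insert b T) := by
    ext i
    simp only [mem_univ, mem_insert, T, mem_filter, true_and, Fin.ext_iff, a, b, true_iff]
    omega
  have hgain : ∀ i : Fin (k + 2), k ≤ (i : ℕ) →
      P.gain (completeMinusLastEdge (k + 2)) x i ≤ P.value x - P.f (T.biUnion x) := by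
    intro i hi
    rw [Problem.gain, hNT i hi]
    gcongr
    refine P.monotone _ _ (union_subset (subset_biUnion_of_mem x (mem_univ i)) ?_)
    exact biUnion_subset_biUnion_of_subset_left x (subset_univ _)
  rw [huniv, sum_insert haT, sum_insert hbT, P.sum_gain_eq x T hN] at h1
  have ha := hgain a le_rfl
  have hb := hgain b (Nat.le_succ k)
  linarith

/-! ### Comparison of the two bounds -/

/-- All graphs with fewer edges than the complement Turán graph with one part less do no better. -/
theorem efficiency_le_of_card_lt {H : OrderedGraph n} {s : ℕ} (hs : 1 ≤ s) (hn : s + 1 < n)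
    (hH : H.edges.card < turanCount n s) (hne : H ≠ completeMinusLastEdge n) :
    efficiency H ≤ 1 / ((s : ℝ) + 1 + 1) := by
  obtain ⟨I, w, hI, hc⟩ := (H.exists_isExtendable_or_eq hs hn hH).resolve_right hne
  have := efficiency_le_of_isExtendable hI
  rwa [hc, Nat.cast_add, Nat.cast_one] at this

theorem exists_isOptimalComplementTuran (n m : ℕ) :
    ∃ G : OrderedGraph n, IsOptimalComplementTuran m G := by
  classical
  have hex : ∃ r, ∃ G : OrderedGraph n, IsComplementTuran r G ∧ G.edges.card ≤ m := by
    refine ⟨n, ⟨∅, by simp⟩, ⟨id, ?_, ?_⟩, by simp⟩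
    · intro a b
      simp [filter_eq']
    · intro i j
      simp only [notMem_empty, id, false_iff, not_and]
      exact fun h => h.ne
  obtain ⟨G, hG, hm⟩ := Nat.find_spec hex
  exact ⟨G, _, hG, hm, fun r' H hH hHm => Nat.find_min' hex ⟨H, hH, hHm⟩⟩

theorem OrderedGraph.eq_of_le_one (hn : n ≤ 1) (G H : OrderedGraph n) : G = H := by
  have : ∀ K : OrderedGraph n, K.edges = ∅ := fun K =>
    eq_empty_of_forall_notMem fun e he => by
      have := K.lt_of_mem e he
      simp only [Fin.lt_def] at this
      omega
  ext1
  rw [this, this]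

theorem OrderedGraph.eq_of_card_le_zero {G H : OrderedGraph n} (hG : G.edges.card ≤ 0)
    (hH : H.edges.card ≤ 0) : G = H := by
  ext1
  rw [card_eq_zero.1 (Nat.le_zero.1 hG), card_eq_zero.1 (Nat.le_zero.1 hH)]

theorem turanCount_pred_self (hn : 2 ≤ n) : turanCount n (n - 1) = 1 := by
  obtain ⟨k, rfl⟩ := Nat.exists_eq_add_of_le' hn
  rw [show k + 2 - 1 = k + 1 from rfl, turanCount, sum_range_succ,
    sum_eq_zero fun j hj => Nat.div_eq_of_lt (mem_range.1 hj)]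
  simp

theorem isEfficiencyMaximizer_of_isOptimalComplementTuran {m : ℕ} (hm : m ≤ n * (n - 1) / 2)
    (hm' : m + 1 ≠ n * (n - 1) / 2) {G : OrderedGraph n} (hG : IsOptimalComplementTuran m G) :
    IsEfficiencyMaximizer m G := by
  obtain ⟨r, hr, hGm, hmin⟩ := hG
  refine ⟨hGm, fun H hH => ?_⟩
  rcases Nat.lt_or_ge n 2 with hn | hn
  · rw [G.eq_of_le_one (by omega) H]
  have hlt : ∀ s, 0 < s → s < r → m < turanCount n s := by
    intro s hs hsr
    by_contra! hcon
    rw [← card_edges_complementTuran n hs] at hcon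
    exact absurd (hmin s _ (isComplementTuran_complementTuran n hs) hcon) (by omega)
  rcases Nat.lt_or_ge r n with hrn | hrn
  · refine le_trans ?_ (le_efficiency_of_isComplementTuran hn hr)
    have hr0 : 0 < r := by
      obtain ⟨c, -⟩ := hr
      exact Fin.pos (c ⟨0, by omega⟩)
    obtain ⟨s, rfl⟩ : ∃ s, r = s + 1 := ⟨r - 1, by omega⟩
    rcases Nat.eq_zero_or_pos s with rfl | hs
    · simpa using efficiency_le_of_isExtendable
        (H.isExtendable_singleton (i := ⟨0, by omega⟩) (j := ⟨1, by omega⟩) (by simp [Fin.lt_def]))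
    · rw [Nat.cast_add, Nat.cast_one]
      refine efficiency_le_of_card_lt hs hrn (hH.trans_lt (hlt s hs (by omega))) ?_
      -- The exceptional graph misses one edge, so it fits only if m is complete or one short;
      -- minimality of r > 1 excludes the former, `hm'` the latter.
      rintro rfl
      have h1 := card_edges_completeMinusLastEdge n hn
      have h2 := hlt 1 one_pos (by omega)
      rw [turanCount_one] at h2
      omega
  -- Here r ≥ n forces m = 0, so both graphs are edgeless.
  · have := hlt (n - 1) (by omega) (by omega)
    rw [turanCount_pred_self hn] at this
    rw [G.eq_of_card_le_zero (H := H) (by omega) (by omega)]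

theorem isEfficiencyMaximizer_iff_eq_completeMinusLastEdge {m : ℕ}
    (hm : m + 1 = n * (n - 1) / 2) (G : OrderedGraph n) :
    IsEfficiencyMaximizer m G ↔ G = completeMinusLastEdge n := by
  have hn : 2 ≤ n := by
    by_contra! hn
    interval_cases n <;> simp at hm
  have hcard := card_edges_completeMinusLastEdge n hn
  have hlt : ∀ H : OrderedGraph n, H.edges.card ≤ m → H ≠ completeMinusLastEdge n →
      efficiency H < efficiency (completeMinusLastEdge n) := by
    intro H hH hne
    rcases hn.eq_or_lt with rfl | hn2
    · exact absurd (H.eq_of_card_le_zero (by omega) (by omega)) hne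
    · refine lt_of_lt_of_le ?_ (half_le_efficiency_completeMinusLastEdge hn)
      refine (efficiency_le_of_card_lt le_rfl hn2 ?_ hne).trans_lt (by norm_num)
      rw [turanCount_one]
      omega
  constructor
  · intro h
    by_contra hne
    exact (h.2 _ (by omega)).not_gt (hlt G h.1 hne)
  · rintro rfl
    refine ⟨by omega, fun H hH => ?_⟩
    by_cases hne : H = completeMinusLastEdge n
    · rw [hne]
    · exact (hlt H hH hne).le

end Efficiency

end DistributedGreedy

theorem theorem2 (n m : ℕ) (hm : m ≤ n * (n - 1) / 2) :
    (m + 1 ≠ n * (n - 1) / 2 →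
      (∃ G : DistributedGreedy.OrderedGraph n,
        DistributedGreedy.IsOptimalComplementTuran m G) ∧
      ∀ G : DistributedGreedy.OrderedGraph n,
        DistributedGreedy.IsOptimalComplementTuran m G →
          DistributedGreedy.IsEfficiencyMaximizer m G) ∧
    (m + 1 = n * (n - 1) / 2 →
      ∀ G : DistributedGreedy.OrderedGraph n,
        DistributedGreedy.IsEfficiencyMaximizer m G ↔
          G = DistributedGreedy.completeMinusLastEdge n) :=
  ⟨fun hm' => ⟨DistributedGreedy.exists_isOptimalComplementTuran n m, fun _ hG =>
      DistributedGreedy.isEfficiencyMaximizer_of_isOptimalComplementTuran hm hm' hG⟩,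
    fun hm' => DistributedGreedy.isEfficiencyMaximizer_iff_eq_completeMinusLastEdge hm'⟩
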